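/- Let $\lambda_1,\lambda_2>0$. The Berger boundary value problem with data $(\lambda_1,\lambda_2)$ asks for real functions $y_1,y_2\in C^\infty([0,1])$ such that, with $K=e^{y_1}$ and $\phi=e^{y_2}$, for all $x\in(0,1)$ $$y_1''+\tfrac16(y_1')^2+\tfrac13(y_2')^2-\frac{1+3x^2}{x(1-x^2)}\,y_1'=0,$$ $$y_1''+\tfrac12(y_1')^2-\frac{5+7x^2}{x(1-x^2)}\,y_1'+\frac{8}{(1-x^2)^2}\left(6-8K^{-1/3}\phi^{-1/3}+2K^{-1/3}\phi^{-4/3}\right)=0,$$ $$y_2''+\tfrac12\,y_1'y_2'-\frac{2(1+2x^2)}{x(1-x^2)}\,y_2'+\frac{32}{(1-x^2)^2}K^{-1/3}\phi^{-1/3}\left(\phi^{-1}-1\right)=0,$$ and $$\phi(0)=\frac{\lambda_2}{\lambda_1},\qquad K(1)=\phi(1)=1,\qquad y_1'(0)=y_2'(0)=y_1'(1)=y_2'(1)=0.$$ **Theorem.** Let $(y_{11},y_{12})$ and $(y_{21},y_{22})$ be two solutions of this boundary value problem with the same data $(\lambda_1,\lambda_2)$, and write $y_{i1}=\log K_i$,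 $y_{i2}=\log\phi_i$. Suppose that $K_1(0)=K_2(0)$ and that the common value $\phi(0)=\lambda_2/\lambda_1$ satisfies $\phi(0)\neq1$ and $\tfrac14<\phi(0)<4$. Then $(y_{11},y_{12})=(y_{21},y_{22})$ on $[0,1]$. -/

import Mathlib

open scoped ContDiff

/-- `IsBergerSolution lam₁ lam₂ y₁ y₂`: the pair `(y₁, y₂)` solves on `[0,1]` the Berger boundary
value problem with boundary data `lam₁, lam₂`. The unknowns are `y₁ = log K` and `y₂ = log φ`, so
`K x = exp (y₁ x)` and `φ x = exp (y₂ x)`. Both are smooth up to the boundary of `[0,1]`; the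
three equations hold on the open interval, where their coefficients are defined; derivatives at the
end points are one-sided. -/
structure IsBergerSolution (lam₁ lam₂ : ℝ) (y₁ y₂ : ℝ → ℝ) : Prop where
  smooth₁ : ContDiffOn ℝ ∞ y₁ (Set.Icc 0 1)
  smooth₂ : ContDiffOn ℝ ∞ y₂ (Set.Icc 0 1)
  /-- `y₁'' + (1/6) (y₁')² + (1/3) (y₂')² - x⁻¹ (1+3x²) (1-x²)⁻¹ y₁' = 0` -/
  eq₁ : ∀ x ∈ Set.Ioo (0 : ℝ) 1,
    deriv (deriv y₁) x + (1 / 6) * (deriv y₁ x) ^ 2 + (1 / 3) * (deriv y₂ x) ^ 2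
      - x⁻¹ * (1 + 3 * x ^ 2) * (1 - x ^ 2)⁻¹ * deriv y₁ x = 0
  /-- `y₁'' + (1/2) (y₁')² - x⁻¹ (5+7x²) (1-x²)⁻¹ y₁'
  + 8 (1-x²)⁻² (6 - 8 K^(-1/3) φ^(-1/3) + 2 K^(-1/3) φ^(-4/3)) = 0` -/
  eq₂ : ∀ x ∈ Set.Ioo (0 : ℝ) 1,
    deriv (deriv y₁) x + (1 / 2) * (deriv y₁ x) ^ 2
      - x⁻¹ * (5 + 7 * x ^ 2) * (1 - x ^ 2)⁻¹ * deriv y₁ x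
      + 8 * ((1 - x ^ 2) ^ 2)⁻¹ *
        (6 - 8 * Real.exp (y₁ x) ^ (-(1 / 3) : ℝ) * Real.exp (y₂ x) ^ (-(1 / 3) : ℝ)
          + 2 * Real.exp (y₁ x) ^ (-(1 / 3) : ℝ) * Real.exp (y₂ x) ^ (-(4 / 3) : ℝ)) = 0
  /-- `y₂'' + (1/2) y₁' y₂' - 2 x⁻¹ (1+2x²) (1-x²)⁻¹ y₂'
  + 32 (1-x²)⁻² K^(-1/3) φ^(-1/3) (φ⁻¹ - 1) = 0` -/
  eq₃ : ∀ x ∈ Set.Ioo (0 : ℝ) 1,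
    deriv (deriv y₂) x + (1 / 2) * deriv y₁ x * deriv y₂ x
      - 2 * x⁻¹ * (1 + 2 * x ^ 2) * (1 - x ^ 2)⁻¹ * deriv y₂ x
      + 32 * ((1 - x ^ 2) ^ 2)⁻¹ *
        Real.exp (y₁ x) ^ (-(1 / 3) : ℝ) * Real.exp (y₂ x) ^ (-(1 / 3) : ℝ) *
        ((Real.exp (y₂ x))⁻¹ - 1) = 0
  phi_zero : Real.exp (y₂ 0) = lam₂ / lam₁
  K_one : Real.exp (y₁ 1) = 1
  phi_one : Real.exp (y₂ 1) = 1
  deriv₁_zero : derivWithin y₁ (Set.Icc 0 1) 0 = 0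
  deriv₂_zero : derivWithin y₂ (Set.Icc 0 1) 0 = 0
  deriv₁_one : derivWithin y₁ (Set.Icc 0 1) 1 = 0
  deriv₂_one : derivWithin y₂ (Set.Icc 0 1) 1 = 0

/-!
A solution describes the metric `g = dt² + a² (σ₁² + σ₂²) + c² σ₃²` on the four-ball, where
`t = -log x`, `dσ₁ = 2 σ₂ ∧ σ₃` and cyclically,
`a = (1 - x²) / (2 x) * K ^ (1/6) * φ ^ (1/6)` and `c = (1 - x²) / (2 x) * K ^ (1/6) * φ ^ (-1/3)`.
The differential equations say that `g` is Einstein with `Ric = -3 g`; `x = 1` is the centre of the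
ball and `x = 0` the conformal infinity. Being regular at
the centre, `g` is half conformally flat, and the
resulting first order system can be integrated.

With a dot for `d/dt = -x d/dx`, let `f = ȧ + c / a` and `η = ċ - c² / a²`. These are, up to the
shift by `2` in `η`, the components of the connection induced on one of the two bundles of
self-dual and anti-self-dual two-forms, and the only independent component of the corresponding half of the Weyl tensor is
`W = f² - 2 η - 4 - a²` divided by `a²`. The Einstein equations give
`ḟ = a - W / (2 a)`, `η̇ = c + c W / a²` and the constraint `2 a (f η - a c) + c W = 0`.

* Consequently `(a W)˙ = -3 (c / a²) (a W)`, so `(a W)²` increases in `x`; as it tends to `0` at the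
  centre, `W = 0` (`IsBergerSolution.weylDefect_eq_zero`).
* Hence `f² = a² + 2 η + 4`, `f η = a c` and `η̇ = c`, so that `(a² - 2 η) / η²` is constant. Its
  limit at infinity is `φ 0`, whence `a² = 2 η + φ(0) η²` (`IsBergerSolution.horizontalRadius_sq`).
* Now `(log η)˙ = c / η` is a decreasing function of `η` alone. For two solutions, with functions
  `η` and `θ`, the square `(log η - log θ)²` therefore increases in `x`. It tends to `0` at the
  centre, because `a² = η (2 + φ(0) η)` and both metrics are asymptotic to the flat one there. So
  `η = θ` (`IsBergerSolution.fibreConnection_eq`).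

Finally `η` determines `a`, by the quadratic relation, and `c = η̇`, hence `K` and `φ`.
-/

open Filter Topology Set

/-! ### Calculus on the unit interval -/

/-- A nonnegative function which is nondecreasing on `(0, 1)` and tends to `0` at `1` vanishes. -/
lemma eq_zero_of_deriv_nonneg {g g' : ℝ → ℝ}
    (hg : ∀ x ∈ Ioo (0 : ℝ) 1, HasDerivAt g (g' x) x) (hg' : ∀ x ∈ Ioo (0 : ℝ) 1, 0 ≤ g' x)
    (hnn : ∀ x ∈ Ioo (0 : ℝ) 1, 0 ≤ g x) (hlim : Tendsto g (𝓝[<] 1) (𝓝 0)) :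
    ∀ x ∈ Ioo (0 : ℝ) 1, g x = 0 := by
  have hmono : MonotoneOn g (Ioo 0 1) := by
    refine monotoneOn_of_hasDerivWithinAt_nonneg (f' := g') (convex_Ioo 0 1)
      (fun x hx => (hg x hx).continuousAt.continuousWithinAt) ?_ ?_
    · intro x hx
      rw [interior_Ioo] at hx
      exact (hg x hx).hasDerivWithinAt
    · intro x hx
      rw [interior_Ioo] at hx
      exact hg' x hx
  intro x hx
  refine le_antisymm (ge_of_tendsto hlim ?_) (hnn x hx)
  filter_upwards [Ioo_mem_nhdsLT hx.2] with z hz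
  exact hmono hx ⟨hx.1.trans hz.1, hz.2⟩ hz.1.le

lemma hasDerivAt_of_contDiffOn {y : ℝ → ℝ} (hy : ContDiffOn ℝ ∞ y (Icc 0 1)) {x : ℝ}
    (hx : x ∈ Ioo (0 : ℝ) 1) :
    HasDerivAt y (deriv y x) x ∧ HasDerivAt (deriv y) (deriv (deriv y) x) x := by
  have hat : ContDiffAt ℝ 2 y x :=
    (contDiffOn_infty.1 hy 2).contDiffAt (Icc_mem_nhds hx.1 hx.2)
  exact ⟨(hat.differentiableAt (by norm_num)).hasDerivAt,
    ((hat.derivWithin (m := 1) (by norm_num)).differentiableAt (by norm_num)).hasDerivAt⟩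

/-- Inside the interval `deriv` agrees with `derivWithin`, which is continuous up to the boundary. -/
lemma tendsto_deriv_of_contDiffOn {y : ℝ → ℝ} (hy : ContDiffOn ℝ ∞ y (Icc 0 1)) {e : ℝ}
    (he : e ∈ Icc (0 : ℝ) 1) (h0 : derivWithin y (Icc 0 1) e = 0) :
    Tendsto (deriv y) (𝓝[Ioo 0 1] e) (𝓝 0) := by
  have hc := ((contDiffOn_infty.1 hy 1).continuousOn_derivWithin (uniqueDiffOn_Icc zero_lt_one)
    le_rfl) e he
  rw [ContinuousWithinAt, h0] at hc
  refine (hc.mono_left (nhdsWithin_mono e Ioo_subset_Icc_self)).congr' ?_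
  filter_upwards [self_mem_nhdsWithin] with x hx
  exact derivWithin_of_mem_nhds (Icc_mem_nhds hx.1 hx.2)

lemma tendsto_of_contDiffOn {y : ℝ → ℝ} (hy : ContDiffOn ℝ ∞ y (Icc 0 1)) {e : ℝ}
    (he : e ∈ Icc (0 : ℝ) 1) : Tendsto y (𝓝[Ioo 0 1] e) (𝓝 (y e)) :=
  (hy.continuousOn e he).mono_left (nhdsWithin_mono e Ioo_subset_Icc_self)

/-! ### The metric coefficients and the connection -/

/-- The coefficient `K ^ (1/6) * φ ^ (1/6)` of the rescaled metric in the directions of `σ₁`, `σ₂`. -/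
noncomputable def horizontalScale (y₁ y₂ : ℝ → ℝ) (x : ℝ) : ℝ := Real.exp ((y₁ x + y₂ x) / 6)

/-- The coefficient `K ^ (1/6) * φ ^ (-1/3)` of the rescaled metric in the direction of `σ₃`, which
is tangent to the Hopf fibres. -/
noncomputable def fibreScale (y₁ y₂ : ℝ → ℝ) (x : ℝ) : ℝ := Real.exp ((y₁ x - 2 * y₂ x) / 6)

/-- The radius `a` of the metric in the directions of `σ₁`, `σ₂`; the factor `(1 - x²) / (2 x)` is
`sinh t` for `x = exp (-t)`. -/
noncomputable def horizontalRadius (y₁ y₂ : ℝ → ℝ) (x : ℝ) : ℝ :=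
  (1 - x ^ 2) / (2 * x) * horizontalScale y₁ y₂ x

/-- The radius `c` of the metric in the direction of `σ₃`. -/
noncomputable def fibreRadius (y₁ y₂ : ℝ → ℝ) (x : ℝ) : ℝ :=
  (1 - x ^ 2) / (2 * x) * fibreScale y₁ y₂ x

/-- The component `f = ȧ + c / a` of the induced connection along `σ₁`, `σ₂`, with `ȧ = -x da/dx`
written out. -/
noncomputable def horizontalConnection (y₁ y₂ : ℝ → ℝ) (x : ℝ) : ℝ :=
  (1 + x ^ 2) / (2 * x) * horizontalScale y₁ y₂ x
    - (1 - x ^ 2) / 12 * horizontalScale y₁ y₂ x * (deriv y₁ x + deriv y₂ x)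
    + fibreScale y₁ y₂ x / horizontalScale y₁ y₂ x

/-- The function `η = ċ - c² / a²`, where `ċ = -x dc/dx` is written out. The component along `σ₃` of
the induced connection is `η + 2`; the shift makes `η` vanish at the centre `x = 1`. -/
noncomputable def fibreConnection (y₁ y₂ : ℝ → ℝ) (x : ℝ) : ℝ :=
  (1 + x ^ 2) / (2 * x) * fibreScale y₁ y₂ x
    - (1 - x ^ 2) / 12 * fibreScale y₁ y₂ x * (deriv y₁ x - 2 * deriv y₂ x)
    - (fibreScale y₁ y₂ x / horizontalScale y₁ y₂ x) ^ 2

/-- The expression `W = f² - 2 η - 4 - a²`; for an Einstein metric, `W / a²` is the independent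
component of one half of the Weyl tensor. -/
noncomputable def weylDefect (y₁ y₂ : ℝ → ℝ) (x : ℝ) : ℝ :=
  horizontalConnection y₁ y₂ x ^ 2 - 2 * fibreConnection y₁ y₂ x - 4
    - horizontalRadius y₁ y₂ x ^ 2

lemma horizontalRadius_pos (y₁ y₂ : ℝ → ℝ) {x : ℝ} (hx : x ∈ Ioo (0 : ℝ) 1) :
    0 < horizontalRadius y₁ y₂ x :=
  mul_pos (div_pos (by nlinarith [hx.1, hx.2]) (by linarith [hx.1])) (Real.exp_pos _)

lemma fibreRadius_pos (y₁ y₂ : ℝ → ℝ) {x : ℝ} (hx : x ∈ Ioo (0 : ℝ) 1) :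
    0 < fibreRadius y₁ y₂ x :=
  mul_pos (div_pos (by nlinarith [hx.1, hx.2]) (by linarith [hx.1])) (Real.exp_pos _)

namespace IsBergerSolution

variable {lam₁ lam₂ : ℝ} {y₁ y₂ : ℝ → ℝ}

/-! ### The Einstein equations as a first order system -/

/-- The difference of the first two equations, and the third one, with the real powers of `K` and
`φ` expressed through the coefficients of the rescaled metric. -/
lemma algebraic_equations (h : IsBergerSolution lam₁ lam₂ y₁ y₂) {x : ℝ}
    (hx : x ∈ Ioo (0 : ℝ) 1) :
    (1 / 3 * (deriv y₁ x ^ 2 - deriv y₂ x ^ 2) - x⁻¹ * (4 + 4 * x ^ 2) * (1 - x ^ 2)⁻¹ * deriv y₁ x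
      + 8 * ((1 - x ^ 2) ^ 2)⁻¹ * (6 - 8 * (horizontalScale y₁ y₂ x ^ 2)⁻¹
        + 2 * fibreScale y₁ y₂ x ^ 2 * (horizontalScale y₁ y₂ x ^ 4)⁻¹) = 0) ∧
    (deriv (deriv y₂) x + (1 / 2) * deriv y₁ x * deriv y₂ x
      - 2 * x⁻¹ * (1 + 2 * x ^ 2) * (1 - x ^ 2)⁻¹ * deriv y₂ x
      + 32 * ((1 - x ^ 2) ^ 2)⁻¹ * (horizontalScale y₁ y₂ x ^ 2)⁻¹ *
        (fibreScale y₁ y₂ x ^ 2 * (horizontalScale y₁ y₂ x ^ 2)⁻¹ - 1) = 0) := by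
  have e1 : Real.exp (y₁ x) ^ (-(1 / 3) : ℝ) * Real.exp (y₂ x) ^ (-(1 / 3) : ℝ)
      = (horizontalScale y₁ y₂ x ^ 2)⁻¹ := by
    rw [horizontalScale, ← Real.exp_mul, ← Real.exp_mul, ← Real.exp_nat_mul, ← Real.exp_neg,
      ← Real.exp_add]
    congr 1; push_cast; ring
  have e2 : Real.exp (y₁ x) ^ (-(1 / 3) : ℝ) * Real.exp (y₂ x) ^ (-(4 / 3) : ℝ)
      = fibreScale y₁ y₂ x ^ 2 * (horizontalScale y₁ y₂ x ^ 4)⁻¹ := by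
    rw [horizontalScale, fibreScale, ← Real.exp_mul, ← Real.exp_mul, ← Real.exp_nat_mul,
      ← Real.exp_nat_mul, ← Real.exp_neg, ← Real.exp_add, ← Real.exp_add]
    congr 1; push_cast; ring
  have e3 : (Real.exp (y₂ x))⁻¹ = fibreScale y₁ y₂ x ^ 2 * (horizontalScale y₁ y₂ x ^ 2)⁻¹ := by
    rw [horizontalScale, fibreScale, ← Real.exp_nat_mul,
      ← Real.exp_nat_mul, ← Real.exp_neg, ← Real.exp_neg, ← Real.exp_add]
    congr 1; push_cast; ring
  have h1 := h.eq₁ x hx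
  have h2 := h.eq₂ x hx
  have h3 := h.eq₃ x hx
  rw [e3] at h3
  constructor
  · linear_combination h2 - h1 - 8 * ((1 - x ^ 2) ^ 2)⁻¹ * (2 * e2 - 8 * e1)
  · linear_combination h3 - 32 * ((1 - x ^ 2) ^ 2)⁻¹ *
      (fibreScale y₁ y₂ x ^ 2 * (horizontalScale y₁ y₂ x ^ 2)⁻¹ - 1) * e1

lemma hasDerivAt_scales (h : IsBergerSolution lam₁ lam₂ y₁ y₂) {x : ℝ}
    (hx : x ∈ Ioo (0 : ℝ) 1) :
    HasDerivAt (horizontalScale y₁ y₂)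
      (horizontalScale y₁ y₂ x * ((deriv y₁ x + deriv y₂ x) / 6)) x ∧
    HasDerivAt (fibreScale y₁ y₂)
      (fibreScale y₁ y₂ x * ((deriv y₁ x - 2 * deriv y₂ x) / 6)) x := by
  have d1 := (hasDerivAt_of_contDiffOn h.smooth₁ hx).1
  have d2 := (hasDerivAt_of_contDiffOn h.smooth₂ hx).1
  exact ⟨((d1.add d2).div_const 6).exp, ((d1.sub (d2.const_mul 2)).div_const 6).exp⟩

lemma hasDerivAt_horizontalRadius (h : IsBergerSolution lam₁ lam₂ y₁ y₂) {x : ℝ}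
    (hx : x ∈ Ioo (0 : ℝ) 1) :
    HasDerivAt (horizontalRadius y₁ y₂)
      (-(horizontalConnection y₁ y₂ x - fibreRadius y₁ y₂ x / horizontalRadius y₁ y₂ x) / x) x := by
  have hx0 : x ≠ 0 := hx.1.ne'
  have hx1 : 1 - x ^ 2 ≠ 0 := by nlinarith [hx.1, hx.2]
  have hA : horizontalScale y₁ y₂ x ≠ 0 := (Real.exp_pos _).ne'
  have hd := (((hasDerivAt_const x (1 : ℝ)).sub (hasDerivAt_pow 2 x)).div
    ((hasDerivAt_id x).const_mul 2) (by simpa using hx0)).mul (h.hasDerivAt_scales hx).1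
  refine hd.congr_deriv ?_
  simp only [horizontalConnection, fibreRadius, horizontalRadius, Pi.sub_apply, Pi.div_apply, id]
  generalize horizontalScale y₁ y₂ x = A at *
  generalize fibreScale y₁ y₂ x = C at *
  field_simp
  push_cast
  ring

/-- The Einstein equation `ḟ = a - W / (2 a)`. -/
lemma hasDerivAt_horizontalConnection (h : IsBergerSolution lam₁ lam₂ y₁ y₂) {x : ℝ}
    (hx : x ∈ Ioo (0 : ℝ) 1) :
    HasDerivAt (horizontalConnection y₁ y₂)
      (-(horizontalRadius y₁ y₂ x - weylDefect y₁ y₂ x / (2 * horizontalRadius y₁ y₂ x)) / x)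
      x := by
  have hx0 : x ≠ 0 := hx.1.ne'
  have hx1 : 1 - x ^ 2 ≠ 0 := by nlinarith [hx.1, hx.2]
  have hA : horizontalScale y₁ y₂ x ≠ 0 := (Real.exp_pos _).ne'
  obtain ⟨dA, dC⟩ := h.hasDerivAt_scales hx
  have hd := ((((((hasDerivAt_pow 2 x).const_add 1).div
    ((hasDerivAt_id x).const_mul 2) (by simpa using hx0)).mul dA).sub
    (((((hasDerivAt_pow 2 x).const_sub 1).div_const 12).mul dA).mul
      ((hasDerivAt_of_contDiffOn h.smooth₁ hx).2.add
        (hasDerivAt_of_contDiffOn h.smooth₂ hx).2))).add (dC.div dA hA))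
  refine hd.congr_deriv ?_
  obtain ⟨e2, e3⟩ := h.algebraic_equations hx
  have e1 := h.eq₁ x hx
  simp only [weylDefect, horizontalConnection, fibreConnection, horizontalRadius,
    Pi.div_apply, Pi.add_apply, Pi.mul_apply, id]
  generalize horizontalScale y₁ y₂ x = A at *
  generalize fibreScale y₁ y₂ x = C at *
  generalize deriv (deriv y₁) x = U at *
  generalize deriv (deriv y₂) x = V at *
  generalize deriv y₁ x = p at *
  generalize deriv y₂ x = q at *
  clear hd dA dC
  rw [← sub_eq_zero]
  -- The difference of the two sides is a combination of the field equations `e1`, `e3`, `e2`.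
  trans (-(1 - x ^ 2) * A / 12 * (U + 1 / 6 * p ^ 2 + 1 / 3 * q ^ 2
      - x⁻¹ * (1 + 3 * x ^ 2) * (1 - x ^ 2)⁻¹ * p)
    + (-(1 - x ^ 2) * A / 12) * (V + 1 / 2 * p * q
      - 2 * x⁻¹ * (1 + 2 * x ^ 2) * (1 - x ^ 2)⁻¹ * q
      + 32 * ((1 - x ^ 2) ^ 2)⁻¹ * (A ^ 2)⁻¹ * (C ^ 2 * (A ^ 2)⁻¹ - 1))
    + (-(1 - x ^ 2) * A / 48) * (1 / 3 * (p ^ 2 - q ^ 2)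
      - x⁻¹ * (4 + 4 * x ^ 2) * (1 - x ^ 2)⁻¹ * p
      + 8 * ((1 - x ^ 2) ^ 2)⁻¹ * (6 - 8 * (A ^ 2)⁻¹ + 2 * C ^ 2 * (A ^ 4)⁻¹)))
  · field_simp
    push_cast
    ring
  · rw [e1, e2, e3]
    ring

lemma hasDerivAt_fibreRadius (h : IsBergerSolution lam₁ lam₂ y₁ y₂) {x : ℝ}
    (hx : x ∈ Ioo (0 : ℝ) 1) :
    HasDerivAt (fibreRadius y₁ y₂)
      (-(fibreConnection y₁ y₂ x + fibreRadius y₁ y₂ x ^ 2 / horizontalRadius y₁ y₂ x ^ 2) / x)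
      x := by
  have hx0 : x ≠ 0 := hx.1.ne'
  have hx1 : 1 - x ^ 2 ≠ 0 := by nlinarith [hx.1, hx.2]
  have hA : horizontalScale y₁ y₂ x ≠ 0 := (Real.exp_pos _).ne'
  have hd := (((hasDerivAt_const x (1 : ℝ)).sub (hasDerivAt_pow 2 x)).div
    ((hasDerivAt_id x).const_mul 2) (by simpa using hx0)).mul (h.hasDerivAt_scales hx).2
  refine hd.congr_deriv ?_
  simp only [fibreConnection, fibreRadius, horizontalRadius, Pi.sub_apply, Pi.div_apply, id]
  generalize horizontalScale y₁ y₂ x = A at *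
  generalize fibreScale y₁ y₂ x = C at *
  field_simp
  push_cast
  ring

/-- The Einstein equation `η̇ = c + c W / a²`. -/
lemma hasDerivAt_fibreConnection (h : IsBergerSolution lam₁ lam₂ y₁ y₂) {x : ℝ}
    (hx : x ∈ Ioo (0 : ℝ) 1) :
    HasDerivAt (fibreConnection y₁ y₂)
      (-(fibreRadius y₁ y₂ x + fibreRadius y₁ y₂ x * weylDefect y₁ y₂ x
        / horizontalRadius y₁ y₂ x ^ 2) / x) x := by
  have hx0 : x ≠ 0 := hx.1.ne'
  have hx1 : 1 - x ^ 2 ≠ 0 := by nlinarith [hx.1, hx.2]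
  have hA : horizontalScale y₁ y₂ x ≠ 0 := (Real.exp_pos _).ne'
  obtain ⟨dA, dC⟩ := h.hasDerivAt_scales hx
  have hd := ((((((hasDerivAt_pow 2 x).const_add 1).div
    ((hasDerivAt_id x).const_mul 2) (by simpa using hx0)).mul dC).sub
    (((((hasDerivAt_pow 2 x).const_sub 1).div_const 12).mul dC).mul
      ((hasDerivAt_of_contDiffOn h.smooth₁ hx).2.sub
        ((hasDerivAt_of_contDiffOn h.smooth₂ hx).2.const_mul 2)))).sub ((dC.div dA hA).pow 2))
  refine hd.congr_deriv ?_
  obtain ⟨e2, e3⟩ := h.algebraic_equations hx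
  have e1 := h.eq₁ x hx
  simp only [weylDefect, horizontalConnection, fibreConnection, horizontalRadius, fibreRadius,
    Pi.sub_apply, Pi.div_apply, Pi.mul_apply, id, Nat.cast_ofNat, Nat.reduceSub, pow_one]
  generalize horizontalScale y₁ y₂ x = A at *
  generalize fibreScale y₁ y₂ x = C at *
  generalize deriv (deriv y₁) x = U at *
  generalize deriv (deriv y₂) x = V at *
  generalize deriv y₁ x = p at *
  generalize deriv y₂ x = q at *
  clear hd dA dC
  rw [← sub_eq_zero]
  -- The difference of the two sides is a combination of the field equations `e1`, `e3`, `e2`.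
  trans (-(1 - x ^ 2) * C / 12 * (U + 1 / 6 * p ^ 2 + 1 / 3 * q ^ 2
      - x⁻¹ * (1 + 3 * x ^ 2) * (1 - x ^ 2)⁻¹ * p)
    + ((1 - x ^ 2) * C / 6) * (V + 1 / 2 * p * q
      - 2 * x⁻¹ * (1 + 2 * x ^ 2) * (1 - x ^ 2)⁻¹ * q
      + 32 * ((1 - x ^ 2) ^ 2)⁻¹ * (A ^ 2)⁻¹ * (C ^ 2 * (A ^ 2)⁻¹ - 1))
    + ((1 - x ^ 2) * C / 24) * (1 / 3 * (p ^ 2 - q ^ 2)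
      - x⁻¹ * (4 + 4 * x ^ 2) * (1 - x ^ 2)⁻¹ * p
      + 8 * ((1 - x ^ 2) ^ 2)⁻¹ * (6 - 8 * (A ^ 2)⁻¹ + 2 * C ^ 2 * (A ^ 4)⁻¹)))
  · field_simp
    ring
  · rw [e1, e2, e3]
    ring

/-- The Einstein equation without second derivatives, which comes from the difference of the first
two equations of the boundary value problem. -/
lemma constraint (h : IsBergerSolution lam₁ lam₂ y₁ y₂) {x : ℝ} (hx : x ∈ Ioo (0 : ℝ) 1) :
    2 * horizontalRadius y₁ y₂ x * (horizontalConnection y₁ y₂ x * fibreConnection y₁ y₂ x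
      - horizontalRadius y₁ y₂ x * fibreRadius y₁ y₂ x)
      + fibreRadius y₁ y₂ x * weylDefect y₁ y₂ x = 0 := by
  have hx0 : x ≠ 0 := hx.1.ne'
  have hx1 : 1 - x ^ 2 ≠ 0 := by nlinarith [hx.1, hx.2]
  have hA : horizontalScale y₁ y₂ x ≠ 0 := (Real.exp_pos _).ne'
  obtain ⟨e2, -⟩ := h.algebraic_equations hx
  simp only [weylDefect, horizontalConnection, fibreConnection, horizontalRadius, fibreRadius]
  generalize horizontalScale y₁ y₂ x = A at *
  generalize fibreScale y₁ y₂ x = C at *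
  generalize deriv y₁ x = p at *
  generalize deriv y₂ x = q at *
  trans ((1 - x ^ 2) ^ 3 / (32 * x) * A ^ 2 * C * (1 / 3 * (p ^ 2 - q ^ 2)
      - x⁻¹ * (4 + 4 * x ^ 2) * (1 - x ^ 2)⁻¹ * p
      + 8 * ((1 - x ^ 2) ^ 2)⁻¹ * (6 - 8 * (A ^ 2)⁻¹ + 2 * C ^ 2 * (A ^ 4)⁻¹)))
  · field_simp
    ring
  · rw [e2, mul_zero]

/-! ### Behaviour at the end points -/

lemma tendsto_scales (h : IsBergerSolution lam₁ lam₂ y₁ y₂) {e : ℝ} (he : e ∈ Icc (0 : ℝ) 1) :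
    Tendsto (horizontalScale y₁ y₂) (𝓝[Ioo 0 1] e) (𝓝 (horizontalScale y₁ y₂ e)) ∧
    Tendsto (fibreScale y₁ y₂) (𝓝[Ioo 0 1] e) (𝓝 (fibreScale y₁ y₂ e)) := by
  have t1 := tendsto_of_contDiffOn h.smooth₁ he
  have t2 := tendsto_of_contDiffOn h.smooth₂ he
  exact ⟨(Real.continuous_exp.tendsto _).comp ((t1.add t2).div_const 6),
    (Real.continuous_exp.tendsto _).comp ((t1.sub (t2.const_mul 2)).div_const 6)⟩

lemma y₁_one (h : IsBergerSolution lam₁ lam₂ y₁ y₂) : y₁ 1 = 0 :=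
  (Real.exp_eq_one_iff _).1 h.K_one

lemma y₂_one (h : IsBergerSolution lam₁ lam₂ y₁ y₂) : y₂ 1 = 0 :=
  (Real.exp_eq_one_iff _).1 h.phi_one

/-- The behaviour at the centre, where the metric is asymptotic to the flat one. -/
lemma tendsto_one (h : IsBergerSolution lam₁ lam₂ y₁ y₂) :
    Tendsto (horizontalRadius y₁ y₂) (𝓝[<] 1) (𝓝 0) ∧
    Tendsto (horizontalConnection y₁ y₂) (𝓝[<] 1) (𝓝 2) ∧
    Tendsto (fibreConnection y₁ y₂) (𝓝[<] 1) (𝓝 0) := by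
  rw [← nhdsWithin_Ioo_eq_nhdsLT zero_lt_one]
  have he : (1 : ℝ) ∈ Icc (0 : ℝ) 1 := ⟨zero_le_one, le_rfl⟩
  obtain ⟨tA, tC⟩ := h.tendsto_scales he
  have hA : horizontalScale y₁ y₂ 1 = 1 := by simp [horizontalScale, h.y₁_one, h.y₂_one]
  have hC : fibreScale y₁ y₂ 1 = 1 := by simp [fibreScale, h.y₁_one, h.y₂_one]
  rw [hA] at tA
  rw [hC] at tC
  have tp := tendsto_deriv_of_contDiffOn h.smooth₁ he h.deriv₁_one
  have tq := tendsto_deriv_of_contDiffOn h.smooth₂ he h.deriv₂_one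
  have tx : Tendsto (fun x : ℝ => x) (𝓝[Ioo 0 1] 1) (𝓝 1) :=
    tendsto_id.mono_left nhdsWithin_le_nhds
  have tm : Tendsto (fun x : ℝ => 1 - x ^ 2) (𝓝[Ioo 0 1] 1) (𝓝 (1 - 1 ^ 2)) :=
    (tx.pow 2).const_sub 1
  have tpl : Tendsto (fun x : ℝ => (1 + x ^ 2) / (2 * x)) (𝓝[Ioo 0 1] 1)
      (𝓝 ((1 + 1 ^ 2) / (2 * 1))) :=
    ((tx.pow 2).const_add 1).div (tx.const_mul 2) (by norm_num)
  have tCA := tC.div tA one_ne_zero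
  refine ⟨?_, ?_, ?_⟩
  · exact ((tm.div (tx.const_mul 2) (by norm_num)).mul tA).trans_eq (by norm_num)
  · exact (((tpl.mul tA).sub (((tm.div_const 12).mul tA).mul (tp.add tq))).add tCA).trans_eq
      (by norm_num)
  · exact (((tpl.mul tC).sub (((tm.div_const 12).mul tC).mul
      (tp.sub (tq.const_mul 2)))).sub (tCA.pow 2)).trans_eq (by norm_num)

/-- The behaviour at the conformal infinity: `a` and `η` both grow like `1 / x`. -/
lemma tendsto_zero (h : IsBergerSolution lam₁ lam₂ y₁ y₂) :
    Tendsto (fun x => x * horizontalRadius y₁ y₂ x) (𝓝[>] 0) (𝓝 (horizontalScale y₁ y₂ 0 / 2)) ∧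
    Tendsto (fun x => x * fibreConnection y₁ y₂ x) (𝓝[>] 0) (𝓝 (fibreScale y₁ y₂ 0 / 2)) := by
  rw [← nhdsWithin_Ioo_eq_nhdsGT zero_lt_one]
  have he : (0 : ℝ) ∈ Icc (0 : ℝ) 1 := ⟨le_rfl, zero_le_one⟩
  obtain ⟨tA, tC⟩ := h.tendsto_scales he
  have tp := tendsto_deriv_of_contDiffOn h.smooth₁ he h.deriv₁_zero
  have tq := tendsto_deriv_of_contDiffOn h.smooth₂ he h.deriv₂_zero
  have tx : Tendsto (fun x : ℝ => x) (𝓝[Ioo 0 1] 0) (𝓝 0) :=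
    tendsto_id.mono_left nhdsWithin_le_nhds
  have tCA := tC.div tA (Real.exp_pos _).ne'
  constructor
  · have t := (((tx.pow 2).const_sub 1).div_const 2).mul tA
    refine (t.congr' ?_).trans_eq (by congr 1; ring)
    filter_upwards [self_mem_nhdsWithin] with x hx
    have hx0 : x ≠ 0 := hx.1.ne'
    simp only [horizontalRadius]
    field_simp
  · have t := (((((tx.pow 2).const_add 1).div_const 2).mul tC).sub
      (tx.mul ((((tx.pow 2).const_sub 1).div_const 12).mul tC |>.mul
        (tp.sub (tq.const_mul 2))))).sub (tx.mul (tCA.pow 2))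
    refine (t.congr' ?_).trans_eq (by congr 1; ring)
    filter_upwards [self_mem_nhdsWithin] with x hx
    have hx0 : x ≠ 0 := hx.1.ne'
    simp only [fibreConnection, Pi.div_apply]
    field_simp

/-! ### Half conformal flatness and the first integral -/

/-- Half of the Weyl tensor vanishes: `(a W)²` is nondecreasing in `x`, since its `x`-derivative is
`6 c W² / x`, and it tends to `0` at the centre. -/
lemma weylDefect_eq_zero (h : IsBergerSolution lam₁ lam₂ y₁ y₂) {x : ℝ}
    (hx : x ∈ Ioo (0 : ℝ) 1) : weylDefect y₁ y₂ x = 0 := by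
  have key : ∀ x ∈ Ioo (0 : ℝ) 1, (horizontalRadius y₁ y₂ x * weylDefect y₁ y₂ x) ^ 2 = 0 := by
    refine eq_zero_of_deriv_nonneg
      (g' := fun x => 6 * fibreRadius y₁ y₂ x * weylDefect y₁ y₂ x ^ 2 / x) ?_ ?_ ?_ ?_
    · intro x hx
      have hx0 : x ≠ 0 := hx.1.ne'
      have ha : horizontalRadius y₁ y₂ x ≠ 0 := (horizontalRadius_pos y₁ y₂ hx).ne'
      have da := h.hasDerivAt_horizontalRadius hx
      have hd := (da.mul (((((h.hasDerivAt_horizontalConnection hx).pow 2).sub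
        ((h.hasDerivAt_fibreConnection hx).const_mul 2)).sub_const 4).sub (da.pow 2))).pow 2
      refine hd.congr_deriv ?_
      have hW : horizontalConnection y₁ y₂ x ^ 2 - 2 * fibreConnection y₁ y₂ x - 4
        - horizontalRadius y₁ y₂ x ^ 2 = weylDefect y₁ y₂ x := rfl
      simp only [Pi.sub_apply, Pi.mul_apply, Pi.pow_apply, hW]
      field_simp
      push_cast
      ring
    · intro x hx
      have := fibreRadius_pos y₁ y₂ hx
      have := hx.1
      positivity
    · intro x hx
      positivity
    · obtain ⟨ta, tf, tη⟩ := h.tendsto_one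
      exact ((ta.mul ((((tf.pow 2).sub (tη.const_mul 2)).sub_const 4).sub (ta.pow 2))).pow
        2).trans_eq (by norm_num)
  have := pow_eq_zero_iff two_ne_zero |>.1 (key x hx)
  exact (mul_eq_zero.1 this).resolve_left (horizontalRadius_pos y₁ y₂ hx).ne'

lemma horizontalConnection_sq (h : IsBergerSolution lam₁ lam₂ y₁ y₂) {x : ℝ}
    (hx : x ∈ Ioo (0 : ℝ) 1) : horizontalConnection y₁ y₂ x ^ 2 =
      horizontalRadius y₁ y₂ x ^ 2 + 2 * fibreConnection y₁ y₂ x + 4 := by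
  have := h.weylDefect_eq_zero hx
  rw [weylDefect] at this
  linarith

lemma horizontalConnection_mul_fibreConnection (h : IsBergerSolution lam₁ lam₂ y₁ y₂) {x : ℝ}
    (hx : x ∈ Ioo (0 : ℝ) 1) : horizontalConnection y₁ y₂ x * fibreConnection y₁ y₂ x =
      horizontalRadius y₁ y₂ x * fibreRadius y₁ y₂ x := by
  have hc := h.constraint hx
  rw [h.weylDefect_eq_zero hx, mul_zero, add_zero] at hc
  have ha := horizontalRadius_pos y₁ y₂ hx
  exact sub_eq_zero.1 ((mul_eq_zero.1 hc).resolve_left (by positivity))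

lemma hasDerivAt_fibreConnection' (h : IsBergerSolution lam₁ lam₂ y₁ y₂) {x : ℝ}
    (hx : x ∈ Ioo (0 : ℝ) 1) :
    HasDerivAt (fibreConnection y₁ y₂) (-fibreRadius y₁ y₂ x / x) x := by
  simpa [h.weylDefect_eq_zero hx] using h.hasDerivAt_fibreConnection hx

/-- `η` is strictly decreasing in `x` and tends to `0` at `x = 1`. -/
lemma fibreConnection_pos (h : IsBergerSolution lam₁ lam₂ y₁ y₂) {x : ℝ}
    (hx : x ∈ Ioo (0 : ℝ) 1) : 0 < fibreConnection y₁ y₂ x := by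
  have hanti : StrictAntiOn (fibreConnection y₁ y₂) (Ioo 0 1) := by
    refine strictAntiOn_of_hasDerivWithinAt_neg (f' := fun x => -fibreRadius y₁ y₂ x / x)
      (convex_Ioo 0 1)
      (fun x hx => (h.hasDerivAt_fibreConnection' hx).continuousAt.continuousWithinAt) ?_ ?_
    · intro x hx
      rw [interior_Ioo] at hx
      exact (h.hasDerivAt_fibreConnection' hx).hasDerivWithinAt
    · intro x hx
      rw [interior_Ioo] at hx
      exact div_neg_of_neg_of_pos (neg_neg_of_pos (fibreRadius_pos y₁ y₂ hx)) hx.1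
  obtain ⟨z, hxz, hz1⟩ := exists_between hx.2
  have hz : z ∈ Ioo (0 : ℝ) 1 := ⟨hx.1.trans hxz, hz1⟩
  refine lt_of_le_of_lt (le_of_tendsto h.tendsto_one.2.2 ?_) (hanti hx hz hxz)
  filter_upwards [Ioo_mem_nhdsLT hz1] with w hw
  exact hanti.antitoneOn hz ⟨hz.1.trans hw.1, hw.2⟩ hw.1.le

/-- The first integral `(a² - 2 η) / η²` is equal to its value `φ 0 = lam₂ / lam₁` at infinity. -/
lemma horizontalRadius_sq (h : IsBergerSolution lam₁ lam₂ y₁ y₂) {x : ℝ}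
    (hx : x ∈ Ioo (0 : ℝ) 1) : horizontalRadius y₁ y₂ x ^ 2 =
      2 * fibreConnection y₁ y₂ x + lam₂ / lam₁ * fibreConnection y₁ y₂ x ^ 2 := by
  set κ : ℝ → ℝ := fun x =>
    (horizontalRadius y₁ y₂ x ^ 2 - 2 * fibreConnection y₁ y₂ x) / fibreConnection y₁ y₂ x ^ 2
    with hκ
  have hderiv : ∀ x ∈ Ioo (0 : ℝ) 1, HasDerivAt κ 0 x := by
    intro x hx
    have hη := (h.fibreConnection_pos hx).ne'
    have dη := h.hasDerivAt_fibreConnection' hx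
    have hd := (((h.hasDerivAt_horizontalRadius hx).pow 2).sub (dη.const_mul 2)).div (dη.pow 2)
      (pow_ne_zero 2 hη)
    refine hd.congr_deriv ?_
    have hx0 : x ≠ 0 := hx.1.ne'
    have ha := (horizontalRadius_pos y₁ y₂ hx).ne'
    have hm := h.horizontalConnection_mul_fibreConnection hx
    simp only [Pi.sub_apply, Pi.pow_apply]
    generalize horizontalRadius y₁ y₂ x = a at *
    generalize horizontalConnection y₁ y₂ x = f at *
    generalize fibreRadius y₁ y₂ x = c at *
    generalize fibreConnection y₁ y₂ x = η at *
    field_simp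
    push_cast
    linear_combination (-2 * a ^ 2 * η) * hm
  have hconst : ∀ z ∈ Ioo (0 : ℝ) 1, κ z = κ x := fun z hz =>
    (convex_Ioo (0 : ℝ) 1).is_const_of_fderivWithin_eq_zero
      (fun w hw => (hderiv w hw).differentiableAt.differentiableWithinAt)
      (fun w hw => by
        rw [fderivWithin_of_isOpen isOpen_Ioo hw]
        ext
        simpa using (hderiv w hw).deriv) hz hx
  have hlim : Tendsto κ (𝓝[>] 0) (𝓝 (lam₂ / lam₁)) := by
    obtain ⟨ta, tη⟩ := h.tendsto_zero
    have tx : Tendsto (fun x : ℝ => x) (𝓝[>] 0) (𝓝 0) := tendsto_id.mono_left nhdsWithin_le_nhds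
    have hC : fibreScale y₁ y₂ 0 ≠ 0 := (Real.exp_pos _).ne'
    have t := ((ta.pow 2).sub ((tx.const_mul 2).mul tη)).div (tη.pow 2) (by positivity)
    refine (t.congr' ?_).trans_eq ?_
    · filter_upwards [Ioo_mem_nhdsGT (zero_lt_one (α := ℝ))] with z hz
      have hz0 : z ≠ 0 := hz.1.ne'
      have hη := (h.fibreConnection_pos hz).ne'
      simp only [hκ, Pi.div_apply]
      field_simp
    · congr 1
      rw [← h.phi_zero]
      have : horizontalScale y₁ y₂ 0 ^ 2 = Real.exp (y₂ 0) * fibreScale y₁ y₂ 0 ^ 2 := by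
        rw [horizontalScale, fibreScale, ← Real.exp_nat_mul, ← Real.exp_nat_mul, ← Real.exp_add]
        congr 1; push_cast; ring
      field_simp
      linear_combination this
  have hval : κ x = lam₂ / lam₁ := by
    refine tendsto_nhds_unique (tendsto_const_nhds.congr' ?_) hlim
    filter_upwards [Ioo_mem_nhdsGT (zero_lt_one (α := ℝ))] with z hz
    exact (hconst z hz).symm
  have hη := (h.fibreConnection_pos hx).ne'
  rw [← hval, hκ]
  field_simp
  ring

/-- The logarithmic rate `c / η` of `η` as a function of `η` alone. -/
lemma fibreRadius_div_sq (h : IsBergerSolution lam₁ lam₂ y₁ y₂) {x : ℝ}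
    (hx : x ∈ Ioo (0 : ℝ) 1) : (fibreRadius y₁ y₂ x / fibreConnection y₁ y₂ x) ^ 2 =
      1 + (2 * fibreConnection y₁ y₂ x + 4) /
        (2 * fibreConnection y₁ y₂ x + lam₂ / lam₁ * fibreConnection y₁ y₂ x ^ 2) := by
  have hη := (h.fibreConnection_pos hx).ne'
  have ha := (horizontalRadius_pos y₁ y₂ hx).ne'
  have hm := h.horizontalConnection_mul_fibreConnection hx
  have hs := h.horizontalConnection_sq hx
  rw [← h.horizontalRadius_sq hx]
  have : fibreRadius y₁ y₂ x / fibreConnection y₁ y₂ x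
      = horizontalConnection y₁ y₂ x / horizontalRadius y₁ y₂ x := by
    rw [div_eq_div_iff hη ha]
    linear_combination -hm
  rw [this, div_pow, hs]
  field_simp
  ring

/-- The relation `a² = η (2 + φ(0) η)` in logarithmic form. The singular first term is the same for
all solutions and cancels in the difference of two of them. -/
lemma log_fibreConnection (h : IsBergerSolution lam₁ lam₂ y₁ y₂) {x : ℝ}
    (hx : x ∈ Ioo (0 : ℝ) 1) : Real.log (fibreConnection y₁ y₂ x) =
      2 * Real.log ((1 - x ^ 2) / (2 * x)) + (y₁ x + y₂ x) / 3
        - Real.log (2 + lam₂ / lam₁ * fibreConnection y₁ y₂ x) := by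
  have hη := h.fibreConnection_pos hx
  have ha := horizontalRadius_pos y₁ y₂ hx
  have hsq := h.horizontalRadius_sq hx
  have hκ : 0 < lam₂ / lam₁ := h.phi_zero ▸ Real.exp_pos _
  have h1 : 0 < (1 - x ^ 2) / (2 * x) := div_pos (by nlinarith [hx.1, hx.2]) (by linarith [hx.1])
  have e : fibreConnection y₁ y₂ x * (2 + lam₂ / lam₁ * fibreConnection y₁ y₂ x)
      = horizontalRadius y₁ y₂ x ^ 2 := by linarith
  have e' := congrArg Real.log e
  rw [Real.log_mul hη.ne' (by positivity), Real.log_pow, horizontalRadius, horizontalScale,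
    Real.log_mul h1.ne' (Real.exp_pos _).ne', Real.log_exp] at e'
  push_cast at e'
  linarith

end IsBergerSolution

/-! ### Comparison of two solutions -/

lemma antitone_rate {κ s t : ℝ} (hκ : 0 < κ) (hs : 0 < s) (hst : s ≤ t) :
    (2 * t + 4) / (2 * t + κ * t ^ 2) ≤ (2 * s + 4) / (2 * s + κ * s ^ 2) := by
  have ht : 0 < t := hs.trans_le hst
  rw [div_le_div_iff₀ (by positivity) (by positivity)]
  have h1 : 0 ≤ t - s := sub_nonneg.2 hst
  have h2 : 0 ≤ (t - s) * (8 + 2 * κ * s * t + 4 * κ * (s + t)) := by positivity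
  linarith

namespace IsBergerSolution

variable {lam₁ lam₂ : ℝ} {y₁ y₂ z₁ z₂ : ℝ → ℝ}

/-- The rate `c / η` is a decreasing function of `η`, the same one for all solutions with the same
data. -/
lemma rate_le (hy : IsBergerSolution lam₁ lam₂ y₁ y₂) (hz : IsBergerSolution lam₁ lam₂ z₁ z₂)
    {x : ℝ} (hx : x ∈ Ioo (0 : ℝ) 1) (hle : fibreConnection y₁ y₂ x ≤ fibreConnection z₁ z₂ x) :
    fibreRadius z₁ z₂ x / fibreConnection z₁ z₂ x
      ≤ fibreRadius y₁ y₂ x / fibreConnection y₁ y₂ x := by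
  have hκ : 0 < lam₂ / lam₁ := hy.phi_zero ▸ Real.exp_pos _
  refine le_of_sq_le_sq ?_ (div_pos (fibreRadius_pos y₁ y₂ hx) (hy.fibreConnection_pos hx)).le
  rw [hy.fibreRadius_div_sq hx, hz.fibreRadius_div_sq hx]
  have := antitone_rate hκ (hy.fibreConnection_pos hx) hle
  linarith

/-- `(log η - log θ)²` is nondecreasing in `x`, because the larger of `η` and `θ` has the smaller
logarithmic rate, and it tends to `0` at the centre. -/
lemma fibreConnection_eq (hy : IsBergerSolution lam₁ lam₂ y₁ y₂)
    (hz : IsBergerSolution lam₁ lam₂ z₁ z₂) {x : ℝ} (hx : x ∈ Ioo (0 : ℝ) 1) :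
    fibreConnection y₁ y₂ x = fibreConnection z₁ z₂ x := by
  have key : ∀ x ∈ Ioo (0 : ℝ) 1, (Real.log (fibreConnection y₁ y₂ x)
      - Real.log (fibreConnection z₁ z₂ x)) ^ 2 = 0 := by
    refine eq_zero_of_deriv_nonneg (g' := fun x => 2 * (Real.log (fibreConnection y₁ y₂ x)
      - Real.log (fibreConnection z₁ z₂ x)) * ((fibreRadius z₁ z₂ x / fibreConnection z₁ z₂ x
        - fibreRadius y₁ y₂ x / fibreConnection y₁ y₂ x) / x)) ?_ ?_ ?_ ?_
    · intro x hx
      have hη := (hy.fibreConnection_pos hx).ne'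
      have hθ := (hz.fibreConnection_pos hx).ne'
      have hd := (((hy.hasDerivAt_fibreConnection' hx).log hη).sub
        ((hz.hasDerivAt_fibreConnection' hx).log hθ)).pow 2
      refine hd.congr_deriv ?_
      simp only [Pi.sub_apply]
      push_cast
      ring
    · intro x hx
      rcases le_total (fibreConnection y₁ y₂ x) (fibreConnection z₁ z₂ x) with hle | hle
      · have h1 := Real.log_le_log (hy.fibreConnection_pos hx) hle
        have h2 := hy.rate_le hz hx hle
        exact mul_nonneg_of_nonpos_of_nonpos (by linarith)
          (div_nonpos_of_nonpos_of_nonneg (by linarith) hx.1.le)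
      · have h1 := Real.log_le_log (hz.fibreConnection_pos hx) hle
        have h2 := hz.rate_le hy hx hle
        exact mul_nonneg (by linarith) (div_nonneg (by linarith) hx.1.le)
    · intro x hx
      positivity
    · have he : (1 : ℝ) ∈ Icc (0 : ℝ) 1 := ⟨zero_le_one, le_rfl⟩
      have lim : ∀ {w₁ w₂ : ℝ → ℝ}, IsBergerSolution lam₁ lam₂ w₁ w₂ →
          Tendsto (fun x => (w₁ x + w₂ x) / 3
            - Real.log (2 + lam₂ / lam₁ * fibreConnection w₁ w₂ x)) (𝓝[<] 1)
            (𝓝 (-Real.log 2)) := by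
        intro w₁ w₂ hw
        have t1 := tendsto_of_contDiffOn hw.smooth₁ he
        have t2 := tendsto_of_contDiffOn hw.smooth₂ he
        rw [nhdsWithin_Ioo_eq_nhdsLT zero_lt_one] at t1 t2
        rw [hw.y₁_one] at t1
        rw [hw.y₂_one] at t2
        have t := ((t1.add t2).div_const 3).sub
          (((hw.tendsto_one.2.2.const_mul (lam₂ / lam₁)).const_add 2).log (by norm_num))
        convert t using 2
        norm_num
      have t := ((lim hy).sub (lim hz)).pow 2
      refine (t.congr' ?_).trans_eq (by norm_num)
      filter_upwards [Ioo_mem_nhdsLT (zero_lt_one (α := ℝ))] with x hx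
      rw [hy.log_fibreConnection hx, hz.log_fibreConnection hx]
      ring
  have := pow_eq_zero_iff two_ne_zero |>.1 (key x hx)
  exact Real.log_injOn_pos (hy.fibreConnection_pos hx) (hz.fibreConnection_pos hx)
    (sub_eq_zero.1 this)

lemma eqOn_Ioo (hy : IsBergerSolution lam₁ lam₂ y₁ y₂)
    (hz : IsBergerSolution lam₁ lam₂ z₁ z₂) {x : ℝ} (hx : x ∈ Ioo (0 : ℝ) 1) :
    y₁ x = z₁ x ∧ y₂ x = z₂ x := by
  have h1 : (1 - x ^ 2) / (2 * x) ≠ 0 :=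
    (div_pos (by nlinarith [hx.1, hx.2]) (by linarith [hx.1])).ne'
  have ha : horizontalRadius y₁ y₂ x = horizontalRadius z₁ z₂ x := by
    refine (pow_left_inj₀ (horizontalRadius_pos y₁ y₂ hx).le (horizontalRadius_pos z₁ z₂ hx).le
      two_ne_zero).1 ?_
    rw [hy.horizontalRadius_sq hx, hz.horizontalRadius_sq hx, hy.fibreConnection_eq hz hx]
  have hc : fibreRadius y₁ y₂ x = fibreRadius z₁ z₂ x := by
    have hd := (hy.hasDerivAt_fibreConnection' hx).congr_of_eventuallyEq
      (f₁ := fibreConnection z₁ z₂) (by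
        filter_upwards [Ioo_mem_nhds hx.1 hx.2] with w hw
        exact (hy.fibreConnection_eq hz hw).symm)
    have := hd.unique (hz.hasDerivAt_fibreConnection' hx)
    rw [div_left_inj' hx.1.ne'] at this
    linarith
  have hA := Real.exp_injective (mul_left_cancel₀ h1 ha)
  have hC := Real.exp_injective (mul_left_cancel₀ h1 hc)
  constructor <;> linarith

end IsBergerSolution

theorem theorem5p2 (lam₁ lam₂ : ℝ) (hlam₁ : 0 < lam₁) (hlam₂ : 0 < lam₂)
    (y₁₁ y₁₂ y₂₁ y₂₂ : ℝ → ℝ)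
    (h₁ : IsBergerSolution lam₁ lam₂ y₁₁ y₁₂)
    (h₂ : IsBergerSolution lam₁ lam₂ y₂₁ y₂₂)
    (hK : Real.exp (y₁₁ 0) = Real.exp (y₂₁ 0))
    (hne : lam₂ / lam₁ ≠ 1) (hlow : 1 / 4 < lam₂ / lam₁) (hupp : lam₂ / lam₁ < 4) :
    ∀ x ∈ Set.Icc (0 : ℝ) 1, y₁₁ x = y₂₁ x ∧ y₁₂ x = y₂₂ x := by
  intro x hx
  rcases hx.1.eq_or_lt with rfl | hx0
  · exact ⟨Real.exp_injective hK, Real.exp_injective (h₁.phi_zero.trans h₂.phi_zero.symm)⟩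
  rcases hx.2.eq_or_lt with rfl | hx1
  · exact ⟨h₁.y₁_one.trans h₂.y₁_one.symm, h₁.y₂_one.trans h₂.y₂_one.symm⟩
  exact h₁.eqOn_Ioo h₂ ⟨hx0, hx1⟩
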